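/- Theorem 1.5. Let $m\ge n$ and let $\Omega\subset\mathbb R^n$ be a connected open set. Let $K=\{A_1,A_2,A_3\}$ be a set of real $m\times n$ matrices with $\operatorname{rank}(A_i-A_j)=n$ whenever $i\ne j$. Let $B$ be a (Lebesgue) measurable $m\times n$ matrix field on $\Omega$ with $B(x)\in K$ for almost every $x\in\Omega$, and suppose that $\operatorname{Div}B=0$ in $\mathcal D'(\Omega,\mathbb R^m)$, that is, every row of $B$ is divergence free in the sense of distributions: $$\int_\Omega \sum_{j=1}^n B_{ij}(x)\,\partial_j\varphi(x)\,dx=0\qquad\text{for all } \varphi\in C_c^\infty(\Omega),\ i=1,\dots,m .$$ Then $B$ is constant almost everywhere: there is $k\in\{1,2,3\}$ such that $B(x)=A_k$ for almost every $x\in\Omega$. In other words, there is no non-constant measurable $B$ with $\operatorname{Div}B=0$ in $\mathcal D'(\Omega,\mathbb R^m)$ and $B(x)\in K$ for almost every $x\in\Omega$. -/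

import Mathlib

open MeasureTheory TopologicalSpace
open scoped Distributions

/-- The matrix field `B` satisfies `Div B = 0` in `𝓓'(Ω, ℝ^m)`, i.e. every row of `B` is divergence
free on `Ω` in the sense of distributions: for every row index `i` and every test function
`φ ∈ C_c^∞(Ω)`, `∫_Ω ∑_j B_{ij}(x) ∂_j φ(x) dx = 0`.
(Meaningful for locally integrable `B`, in particular for measurable `B` with finitely many values;
only the restriction of `B` to `Ω` matters.) -/
def DivEqZero {m n : ℕ} (Ω : Opens (EuclideanSpace ℝ (Fin n)))
    (B : EuclideanSpace ℝ (Fin n) → Matrix (Fin m) (Fin n) ℝ) : Prop :=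
  ∀ (i : Fin m) (φ : 𝓓(Ω, ℝ)),
    ∫ x in (Ω : Set (EuclideanSpace ℝ (Fin n))),
      ∑ j : Fin n, B x i j * fderiv ℝ φ x (EuclideanSpace.single j 1) = 0

section WeakDerivatives

open Filter Topology Metric
open scoped Convolution ContDiff Matrix


/-! Let `u`, `v` be the indicators of the phases `A 1`, `A 2`. Then `B = A 0 + u (A 1 - A 0) + v (A
2 - A 0)`, so each row of `Div B = 0` is a linear relation between weak derivatives of `u` and of
`v`. The rank hypothesis gives `L` with every `L * (A k - A l)`, `k ≠ l`, invertible. With `P = L (A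
1 - A 0)`, `Q = L (A 2 - A 0)` and `M = P⁻¹ Q` acting on row vectors, the relations yield `∂_h u +
∂_{hM} v = 0` for all complex `h`, and neither 0 nor 1 is an eigenvalue of `M`. If `hM = a h`, then
`w = u + a v` satisfies `∂_h w = 0`. Its values 0, 1, `a` are distinct, so `u` and `v` are quadratic
polynomials in `w`; bounded functions killed by `∂_h` form an algebra (`WeakDirDerivZero.mul`),
hence `∂_h u = ∂_h v = 0`. Induction along Jordan chains extends this to generalized eigenvectors,
which span `ℂⁿ`. Both gradients vanish, and connectedness finishes. -/

/-- The derivative of `f` along the complex direction `h`. -/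
noncomputable def dirDeriv {n : ℕ} (h : Fin n → ℂ) (f : EuclideanSpace ℝ (Fin n) → ℂ)
    (x : EuclideanSpace ℝ (Fin n)) : ℂ :=
  ∑ j, h j * fderiv ℝ f x (EuclideanSpace.single j 1)

/-- The derivative of `f` along the complex direction `h` vanishes on `Ω` in the sense of
distributions. -/
def WeakDirDerivZero {n : ℕ} (Ω : Opens (EuclideanSpace ℝ (Fin n))) (h : Fin n → ℂ)
    (f : EuclideanSpace ℝ (Fin n) → ℂ) : Prop :=
  ∀ φ : 𝓓(Ω, ℂ), ∫ x, f x * dirDeriv h φ x = 0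

/-- The convolution of `f` with a normed bump function. -/
noncomputable def mollify {n : ℕ} (ρ : ContDiffBump (0 : EuclideanSpace ℝ (Fin n)))
    (f : EuclideanSpace ℝ (Fin n) → ℂ) : EuclideanSpace ℝ (Fin n) → ℂ :=
  ρ.normed volume ⋆[ContinuousLinearMap.lsmul ℝ ℝ, volume] f

/-! ### Weak derivatives along complex directions -/

section DirectionalDerivative

variable {n : ℕ} {Ω : Opens (EuclideanSpace ℝ (Fin n))} {h : Fin n → ℂ}
  {f g : EuclideanSpace ℝ (Fin n) → ℂ}

theorem continuous_dirDeriv (hf : ContDiff ℝ ∞ f) : Continuous (dirDeriv h f) := by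
  have := hf.continuous_fderiv (by simp)
  unfold dirDeriv
  fun_prop

theorem hasCompactSupport_dirDeriv (hf : HasCompactSupport f) :
    HasCompactSupport (dirDeriv h f) := by
  refine (hf.fderiv (𝕜 := ℝ)).mono fun x hx => ?_
  contrapose! hx
  simp only [Function.mem_support, not_not] at hx
  simp [dirDeriv, hx]

theorem dirDeriv_mul {x : EuclideanSpace ℝ (Fin n)} (hf : DifferentiableAt ℝ f x)
    (hg : DifferentiableAt ℝ g x) :
    dirDeriv h (f * g) x = f x * dirDeriv h g x + dirDeriv h f x * g x := by
  simp only [dirDeriv, fderiv_mul hf hg, Finset.mul_sum, Finset.sum_mul,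
    ← Finset.sum_add_distrib]
  refine Finset.sum_congr rfl fun j _ => ?_
  simp
  ring

theorem MeasureTheory.MemLp.integrable_mul_of_hasCompactSupport
    (hf : MemLp f ⊤ volume) (hg : Continuous g) (hgc : HasCompactSupport g) :
    Integrable (fun x => f x * g x) := by
  simpa [mul_comm, smul_eq_mul] using
    (hf.locallyIntegrable le_top).integrable_smul_left_of_hasCompactSupport hg hgc

theorem integral_mul_dirDeriv (hf : ContDiff ℝ ∞ f) (hg : ContDiff ℝ ∞ g)
    (hgc : HasCompactSupport g) :
    ∫ x, f x * dirDeriv h g x = -∫ x, dirDeriv h f x * g x := by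
  have hf' := hf.continuous_fderiv (by simp)
  have hg' := hg.continuous_fderiv (by simp)
  have hgc' := hgc.fderiv (𝕜 := ℝ)
  have hc (v : EuclideanSpace ℝ (Fin n)) : HasCompactSupport (fun x => fderiv ℝ g x v) :=
    hgc'.comp_left (g := fun L : _ →L[ℝ] ℂ => L v) rfl
  have i1 (v : EuclideanSpace ℝ (Fin n)) : Integrable (fun x => f x * fderiv ℝ g x v) :=
    (hf.continuous.mul (by fun_prop)).integrable_of_hasCompactSupport (hc v).mul_left
  have i2 (v : EuclideanSpace ℝ (Fin n)) : Integrable (fun x => fderiv ℝ f x v * g x) :=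
    (Continuous.mul (by fun_prop) hg.continuous).integrable_of_hasCompactSupport hgc.mul_left
  have i3 : Integrable (fun x => f x * g x) :=
    (hf.continuous.mul hg.continuous).integrable_of_hasCompactSupport hgc.mul_left
  have key (v : EuclideanSpace ℝ (Fin n)) := integral_mul_fderiv_eq_neg_fderiv_mul_of_integrable
    (i2 v) (i1 v) i3 (fun x _ => hf.differentiable (by simp) x)
    (fun x _ => hg.differentiable (by simp) x)
  simp only [dirDeriv, Finset.mul_sum, Finset.sum_mul]
  rw [integral_finsetSum _ fun j _ => by simpa [mul_left_comm] using (i1 _).const_mul (h j),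
    integral_finsetSum _ fun j _ => by simpa [mul_assoc] using (i2 _).const_mul (h j),
    ← Finset.sum_neg_distrib]
  refine Finset.sum_congr rfl fun j _ => ?_
  simp only [mul_left_comm (f _), mul_assoc, integral_const_mul, key, mul_neg]

section Mollify

variable {ρ : ContDiffBump (0 : EuclideanSpace ℝ (Fin n))}

theorem contDiff_mollify (hf : MemLp f ⊤ volume) : ContDiff ℝ ∞ (mollify ρ f) :=
  ρ.hasCompactSupport_normed.contDiff_convolution_left _ ρ.contDiff_normed
    (hf.locallyIntegrable le_top)

theorem norm_mollify_le {C : ℝ} (hf : ∀ᵐ x, ‖f x‖ ≤ C) (x : EuclideanSpace ℝ (Fin n)) :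
    ‖mollify ρ f x‖ ≤ C := by
  have hC : ∀ᵐ t, ‖f (x - t)‖ ≤ C :=
    (volume.measurePreserving_sub_left x).quasiMeasurePreserving.ae hf
  calc ‖mollify ρ f x‖ ≤ ∫ t, ρ.normed volume t * C := by
        refine norm_integral_le_of_norm_le (ρ.integrable_normed.mul_const C) ?_
        filter_upwards [hC] with t ht
        simp only [ContinuousLinearMap.lsmul_apply, norm_smul, Real.norm_eq_abs,
          abs_of_nonneg (ρ.nonneg_normed t)]
        exact mul_le_mul_of_nonneg_left ht (ρ.nonneg_normed t)
    _ = C := by rw [integral_mul_const, ρ.integral_normed, one_mul]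

theorem fderiv_mollify_apply (hf : MemLp f ⊤ volume) (x v : EuclideanSpace ℝ (Fin n)) :
    fderiv ℝ (mollify ρ f) x v = ∫ y, f y * (fderiv ℝ (ρ.normed volume) (x - y) v : ℝ) := by
  have hs : ContDiff ℝ 1 (ρ.normed volume) := ρ.contDiff_normed (n := 1)
  have hl := hf.locallyIntegrable (μ := volume) le_top
  let L := (ContinuousLinearMap.lsmul ℝ ℝ : ℝ →L[ℝ] ℂ →L[ℝ] ℂ)
  have hd := ρ.hasCompactSupport_normed.hasFDerivAt_convolution_left L (μ := volume) hs hl x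
  have he := (ρ.hasCompactSupport_normed.fderiv (𝕜 := ℝ)).convolutionExists_left
    (L.precompL (EuclideanSpace ℝ (Fin n))) (hs.continuous_fderiv one_ne_zero) hl x
  rw [mollify, hd.fderiv, convolution_def, ContinuousLinearMap.integral_apply he,
    ← integral_sub_left_eq_self _ volume x]
  refine integral_congr_ae (.of_forall fun t => ?_)
  simp [L, mul_comm]

theorem dirDeriv_mollify (hf : MemLp f ⊤ volume) (hw : WeakDirDerivZero Ω h f)
    {x : EuclideanSpace ℝ (Fin n)} (hx : closedBall x ρ.rOut ⊆ Ω) :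
    dirDeriv h (mollify ρ f) x = 0 := by
  have hs : ContDiff ℝ ∞ (ρ.normed volume) := ρ.contDiff_normed
  have hd : Differentiable ℝ (ρ.normed volume) := hs.differentiable (by simp)
  have hts : tsupport (fun y => (ρ.normed volume (x - y) : ℂ)) ⊆ closedBall x ρ.rOut := by
    refine closure_minimal (fun y hy => ?_) isClosed_closedBall
    have : x - y ∈ Function.support (ρ.normed volume) := by simpa using hy
    rw [ρ.support_normed_eq] at this
    simpa [dist_eq_norm, norm_sub_rev] using (mem_ball_zero_iff.1 this).le
  -- The reflected, translated kernel is an admissible test function because its support lies in the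
  -- ball around `x`.
  let φ : 𝓓(Ω, ℂ) := ⟨fun y => (ρ.normed volume (x - y) : ℂ),
    Complex.ofRealCLM.contDiff.comp (hs.comp (contDiff_const.sub contDiff_id)),
    (isCompact_closedBall x ρ.rOut).of_isClosed_subset (isClosed_tsupport _) hts,
    hts.trans hx⟩
  have hφ (y v : EuclideanSpace ℝ (Fin n)) :
      fderiv ℝ φ y v = -(fderiv ℝ (ρ.normed volume) (x - y) v : ℝ) := by
    have h1 : HasFDerivAt φ (Complex.ofRealCLM ∘L (fderiv ℝ (ρ.normed volume) (x - y) ∘L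
        (-ContinuousLinearMap.id ℝ _))) y :=
      Complex.ofRealCLM.hasFDerivAt.comp y
        ((hd (x - y)).hasFDerivAt.comp y ((hasFDerivAt_id y).const_sub x))
    rw [h1.fderiv]
    simp
  have hi (v : EuclideanSpace ℝ (Fin n)) :
      Integrable fun y => f y * (fderiv ℝ (ρ.normed volume) (x - y) v : ℝ) := by
    have hc : Continuous fun y => fderiv ℝ φ y v :=
      ((φ.contDiff.continuous_fderiv (by simp)).clm_apply continuous_const)
    have := hf.integrable_mul_of_hasCompactSupport hc
      ((φ.hasCompactSupport.fderiv (𝕜 := ℝ)).comp_left (g := fun L : _ →L[ℝ] ℂ => L v) rfl)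
    simpa [hφ] using this.neg
  have h0 := hw φ
  simp only [dirDeriv, hφ, Finset.mul_sum] at h0
  rw [integral_finsetSum _ fun j _ => by
    simpa [mul_left_comm] using ((hi _).const_mul (h j)).neg] at h0
  simp only [dirDeriv, fderiv_mollify_apply hf, ← integral_const_mul]
  rw [← neg_eq_zero, ← h0, ← Finset.sum_neg_distrib]
  refine Finset.sum_congr rfl fun j _ => ?_
  rw [← integral_neg]
  refine integral_congr_ae (.of_forall fun y => ?_)
  simp only
  ring

end Mollify

theorem exists_shrinking_contDiffBump {δ : ℝ} (hδ : 0 < δ) :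
    ∃ ρ : ℕ → ContDiffBump (0 : EuclideanSpace ℝ (Fin n)), (∀ i, (ρ i).rOut ≤ δ) ∧
      ∀ f : EuclideanSpace ℝ (Fin n) → ℂ, MemLp f ⊤ volume →
        ∀ᵐ x, Tendsto (fun i => mollify (ρ i) f x) atTop (𝓝 (f x)) := by
  -- The fixed ratio 2 of outer to inner radius is the bound `K` needed for almost everywhere
  -- convergence.
  refine ⟨fun i => ⟨δ / (i + 1) / 2, δ / (i + 1), by positivity, half_lt_self (by positivity)⟩,
    fun i => div_le_self hδ.le (by simp), fun f hf => ?_⟩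
  refine ContDiffBump.ae_convolution_tendsto_right_of_locallyIntegrable (K := 2) ?_ ?_
    (hf.locallyIntegrable le_top)
  · simpa [div_eq_mul_inv] using
      (tendsto_one_div_add_atTop_nhds_zero_nat (𝕜 := ℝ)).const_mul δ
  · exact .of_forall fun i => by simp only; linarith

theorem MeasureTheory.MemLp.exists_norm_le (hf : MemLp f ⊤ volume) :
    ∃ C, ∀ᵐ x, ‖f x‖ ≤ C := by
  have hlt := hf.eLpNorm_lt_top
  rw [eLpNorm_exponent_top] at hlt
  refine ⟨(eLpNormEssSup f volume).toReal, ?_⟩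
  filter_upwards [ae_le_eLpNormEssSup (f := f) (μ := volume)] with x hx
  simpa using ENNReal.toReal_mono hlt.ne hx

/-- Near the support of the test function both mollifications are smooth and classically killed by
`∂_h`, so the Leibniz rule applies; the uniform bounds allow dominated convergence. -/
theorem WeakDirDerivZero.mul (hfm : MemLp f ⊤ volume) (hgm : MemLp g ⊤ volume)
    (hf : WeakDirDerivZero Ω h f) (hg : WeakDirDerivZero Ω h g) :
    WeakDirDerivZero Ω h (f * g) := by
  intro φ
  obtain ⟨δ, hδ, hsub⟩ := φ.hasCompactSupport.isCompact.exists_cthickening_subset_open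
    Ω.isOpen φ.tsupport_subset
  obtain ⟨ρ, hρ, hlim⟩ := exists_shrinking_contDiffBump (n := n) hδ
  obtain ⟨C, hC⟩ := hfm.exists_norm_le
  obtain ⟨D, hD⟩ := hgm.exists_norm_le
  have hball (i : ℕ) {x} (hx : x ∈ tsupport φ) : closedBall x (ρ i).rOut ⊆ Ω :=
    (closedBall_subset_closedBall (hρ i)).trans
      ((closedBall_subset_cthickening hx δ).trans hsub)
  have hsm (i : ℕ) : ContDiff ℝ ∞ (mollify (ρ i) f * mollify (ρ i) g) :=
    (contDiff_mollify hfm).mul (contDiff_mollify hgm)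
  have hzero (i : ℕ) : ∫ x, (mollify (ρ i) f * mollify (ρ i) g) x * dirDeriv h φ x = 0 := by
    rw [integral_mul_dirDeriv (hsm i) φ.contDiff φ.hasCompactSupport, neg_eq_zero]
    refine integral_eq_zero_of_ae (.of_forall fun x => ?_)
    by_cases hx : x ∈ tsupport φ
    · simp [dirDeriv_mul ((contDiff_mollify hfm).differentiable (by simp) x)
        ((contDiff_mollify hgm).differentiable (by simp) x),
        dirDeriv_mollify hfm hf (hball i hx), dirDeriv_mollify hgm hg (hball i hx)]
    · simp [image_eq_zero_of_notMem_tsupport hx]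
  have hcd := continuous_dirDeriv (h := h) φ.contDiff
  have ht : Tendsto (fun i => ∫ x, (mollify (ρ i) f * mollify (ρ i) g) x * dirDeriv h φ x)
      atTop (𝓝 (∫ x, (f * g) x * dirDeriv h φ x)) := by
    refine tendsto_integral_of_dominated_convergence (fun x => C * D * ‖dirDeriv h φ x‖)
      (fun i => ((hsm i).continuous.mul hcd).aestronglyMeasurable) ?_ ?_ ?_
    · exact (hcd.integrable_of_hasCompactSupport
        (hasCompactSupport_dirDeriv φ.hasCompactSupport)).norm.const_mul _
    · refine fun i => .of_forall fun x => ?_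
      have h1 := norm_mollify_le (ρ := ρ i) hC x
      have h2 := norm_mollify_le (ρ := ρ i) hD x
      rw [norm_mul, Pi.mul_apply, norm_mul]
      gcongr
      exact (norm_nonneg _).trans h1
    · filter_upwards [hlim f hfm, hlim g hgm] with x hx hy
      exact (hx.mul hy).mul_const _
  exact tendsto_nhds_unique ht (by simp only [hzero, tendsto_const_nhds])

theorem WeakDirDerivZero.add (hfm : MemLp f ⊤ volume) (hgm : MemLp g ⊤ volume)
    (hf : WeakDirDerivZero Ω h f) (hg : WeakDirDerivZero Ω h g) :
    WeakDirDerivZero Ω h (f + g) := by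
  intro φ
  have hc := continuous_dirDeriv (h := h) φ.contDiff
  have hs := hasCompactSupport_dirDeriv (h := h) φ.hasCompactSupport
  simp only [Pi.add_apply, add_mul]
  rw [integral_add (hfm.integrable_mul_of_hasCompactSupport hc hs)
    (hgm.integrable_mul_of_hasCompactSupport hc hs), hf φ, hg φ, add_zero]

theorem WeakDirDerivZero.const_mul (c : ℂ) (hf : WeakDirDerivZero Ω h f) :
    WeakDirDerivZero Ω h (fun x => c * f x) := by
  intro φ
  simp only [mul_assoc, integral_const_mul, hf φ, mul_zero]

theorem weakDirDerivZero_const (c : ℂ) : WeakDirDerivZero Ω h fun _ => c := by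
  intro φ
  rw [integral_mul_dirDeriv contDiff_const φ.contDiff φ.hasCompactSupport]
  simp [dirDeriv]

theorem WeakDirDerivZero.congr (hf : WeakDirDerivZero Ω h f)
    (hfg : ∀ᵐ x, x ∈ Ω → f x = g x) : WeakDirDerivZero Ω h g := by
  intro φ
  rw [← hf φ]
  refine integral_congr_ae ?_
  filter_upwards [hfg] with x hx
  by_cases hxΩ : x ∈ Ω
  · rw [hx hxΩ]
  · have : fderiv ℝ φ x = 0 := image_eq_zero_of_notMem_tsupport fun hx' =>
      hxΩ (φ.tsupport_subset (tsupport_fderiv_subset ℝ hx'))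
    simp [dirDeriv, this]

/-- A bounded function whose weak gradient vanishes on a connected open set is a.e. constant. -/
theorem ae_const_of_weakDirDerivZero (hΩ : IsConnected (Ω : Set (EuclideanSpace ℝ (Fin n))))
    (hfm : MemLp f ⊤ volume) (hf : ∀ h, WeakDirDerivZero Ω h f) :
    ∃ c, ∀ᵐ x, x ∈ Ω → f x = c := by
  -- Locally, mollifications have zero gradient on a ball, so they are constant there, and so is
  -- their a.e. limit.
  have hloc : ∀ x ∈ Ω, ∃ c, ∃ r > 0, ∀ᵐ y, y ∈ ball x r → f y = c := by
    intro x hx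
    obtain ⟨R, hR, hsub⟩ := Metric.isOpen_iff.1 Ω.isOpen x hx
    obtain ⟨ρ, hρ, hlim⟩ := exists_shrinking_contDiffBump (n := n) (half_pos (half_pos hR))
    have hb : ∀ y ∈ ball x (R / 2), ∀ i, closedBall y (ρ i).rOut ⊆ Ω := fun y hy i z hz => by
      refine hsub (mem_ball.2 ?_)
      have := dist_triangle z y x
      have := hρ i
      rw [mem_ball] at hy
      rw [mem_closedBall] at hz
      linarith
    have hder : ∀ y ∈ ball x (R / 2), ∀ i, fderiv ℝ (mollify (ρ i) f) y = 0 := by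
      intro y hy i
      have hj (j : Fin n) : fderiv ℝ (mollify (ρ i) f) y (EuclideanSpace.single j 1) = 0 := by
        simpa [dirDeriv, Pi.single_apply] using
          dirDeriv_mollify hfm (hf (Pi.single j 1)) (hb y hy i)
      have := (EuclideanSpace.basisFun (Fin n) ℝ).toBasis.ext
        (f₁ := (fderiv ℝ (mollify (ρ i) f) y).toLinearMap) (f₂ := 0) (by simpa using hj)
      exact ContinuousLinearMap.coe_injective this
    have hconst : ∀ y ∈ ball x (R / 2), ∀ z ∈ ball x (R / 2), ∀ i,
        mollify (ρ i) f y = mollify (ρ i) f z := fun y hy z hz i =>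
      isOpen_ball.is_const_of_fderiv_eq_zero (𝕜 := ℝ) (convex_ball x (R / 2)).isPreconnected
        ((contDiff_mollify hfm).differentiable (by simp)).differentiableOn
        (fun w hw => hder w hw i) hy hz
    obtain ⟨z, hz, hzl⟩ : ∃ z ∈ ball x (R / 2),
        Tendsto (fun i => mollify (ρ i) f z) atTop (𝓝 (f z)) := by
      exact Measure.exists_mem_of_measure_ne_zero_of_ae
        (measure_ball_pos volume x (half_pos hR)).ne' (ae_restrict_of_ae (hlim f hfm))
    refine ⟨f z, R / 2, half_pos hR, ?_⟩
    filter_upwards [hlim f hfm] with y hyl hy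
    exact tendsto_nhds_unique hyl (by simpa only [hconst y hy z hz] using hzl)
  choose! c r hr hc using hloc
  -- Overlapping balls meet in positive measure, so their local constants agree.
  have heq : ∀ x ∈ Ω, ∀ y ∈ Ω, (ball x (r x) ∩ ball y (r y)).Nonempty → c x = c y := by
    intro x hx y hy hne
    obtain ⟨z, hz, hzx, hzy⟩ := Measure.exists_mem_of_measure_ne_zero_of_ae
      ((isOpen_ball.inter isOpen_ball).measure_pos volume hne).ne'
      (ae_restrict_of_ae ((hc x hx).and (hc y hy)))
    exact (hzx hz.1).symm.trans (hzy hz.2)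
  obtain ⟨x₀, hx₀⟩ := hΩ.nonempty
  let U : Set (EuclideanSpace ℝ (Fin n)) := ⋃ x ∈ {x ∈ Ω | c x = c x₀}, ball x (r x)
  let V : Set (EuclideanSpace ℝ (Fin n)) := ⋃ x ∈ {x ∈ Ω | c x ≠ c x₀}, ball x (r x)
  have hUV : U ∩ V = ∅ := by
    refine Set.eq_empty_of_forall_notMem fun y ⟨hyU, hyV⟩ => ?_
    simp only [U, V, Set.mem_iUnion₂] at hyU hyV
    obtain ⟨x, hx, hyx⟩ := hyU
    obtain ⟨z, hz, hyz⟩ := hyV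
    exact hz.2 ((heq z hz.1 x hx.1 ⟨y, hyz, hyx⟩).trans hx.2)
  have hcov : (Ω : Set (EuclideanSpace ℝ (Fin n))) ⊆ U ∪ V := by
    intro x hx
    by_cases hcx : c x = c x₀
    · exact .inl (Set.mem_biUnion (x := x) ⟨hx, hcx⟩ (mem_ball_self (hr x hx)))
    · exact .inr (Set.mem_biUnion (x := x) ⟨hx, hcx⟩ (mem_ball_self (hr x hx)))
  have hx₀U : x₀ ∈ U := Set.mem_biUnion (x := x₀) ⟨hx₀, rfl⟩ (mem_ball_self (hr x₀ hx₀))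
  have hsub : (Ω : Set (EuclideanSpace ℝ (Fin n))) ⊆ U := by
    refine (isPreconnected_iff_subset_of_disjoint.1 hΩ.isPreconnected U V
      (isOpen_biUnion fun _ _ => isOpen_ball) (isOpen_biUnion fun _ _ => isOpen_ball) hcov
      (by rw [hUV, Set.inter_empty])).resolve_right fun hV => ?_
    exact Set.notMem_empty x₀ (hUV ▸ ⟨hx₀U, hV hx₀⟩)
  refine ⟨c x₀, ae_iff.2 (measure_null_of_locally_null _ fun x hx => ?_)⟩
  simp only [Set.mem_ofPred_eq, Classical.not_imp] at hx
  obtain ⟨y, hy, hxy⟩ := Set.mem_iUnion₂.1 (hsub hx.1)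
  refine ⟨ball y (r y) ∩ {z | ¬(z ∈ Ω → f z = c x₀)},
    Filter.inter_mem (mem_nhdsWithin_of_mem_nhds ?_) self_mem_nhdsWithin,
    measure_mono_null ?_ (ae_iff.1 (hc y hy.1))⟩
  · exact isOpen_ball.mem_nhds hxy
  · rintro z ⟨hz, hz'⟩ hzc
    exact hz' fun _ => (hzc hz).trans hy.2

end DirectionalDerivative

/-! ### The coupled system and its generalized eigenvectors -/

section Coupled

variable {n : ℕ} {Ω : Opens (EuclideanSpace ℝ (Fin n))}

/-- The distributional derivative of `f` paired with `φ`, as a linear form in the direction. -/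
noncomputable def weakDeriv (f φ : EuclideanSpace ℝ (Fin n) → ℂ) : (Fin n → ℂ) →ₗ[ℂ] ℂ :=
  ∑ j, (∫ x, f x * fderiv ℝ φ x (EuclideanSpace.single j 1)) • LinearMap.proj j

theorem weakDeriv_apply {f : EuclideanSpace ℝ (Fin n) → ℂ} (hf : MemLp f ⊤ volume)
    (φ : 𝓓(Ω, ℂ)) (h : Fin n → ℂ) :
    weakDeriv f φ h = ∫ x, f x * dirDeriv h φ x := by
  have hi (v : EuclideanSpace ℝ (Fin n)) : Integrable fun x => f x * fderiv ℝ φ x v :=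
    hf.integrable_mul_of_hasCompactSupport
      ((φ.contDiff.continuous_fderiv (by simp)).clm_apply continuous_const)
      ((φ.hasCompactSupport.fderiv (𝕜 := ℝ)).comp_left (g := fun L : _ →L[ℝ] ℂ => L v) rfl)
  simp only [dirDeriv, Finset.mul_sum]
  rw [integral_finsetSum _ fun j _ => by simpa [mul_left_comm] using (hi _).const_mul (h j)]
  simp [weakDeriv, mul_left_comm _ (h _), integral_const_mul, mul_comm]

theorem weakDirDerivZero_iff {f : EuclideanSpace ℝ (Fin n) → ℂ} (hf : MemLp f ⊤ volume)
    {h : Fin n → ℂ} : WeakDirDerivZero Ω h f ↔ ∀ φ : 𝓓(Ω, ℂ), weakDeriv f φ h = 0 := by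
  simp only [WeakDirDerivZero, weakDeriv_apply hf]

/-- The values `0, 1, a` of `u + a v` determine those of `u` and `v`, so these inherit the
vanishing of directional derivatives. -/
theorem WeakDirDerivZero.of_add_const_mul {u v : EuclideanSpace ℝ (Fin n) → ℂ}
    (hu : MemLp u ⊤ volume) (hv : MemLp v ⊤ volume)
    (huv : ∀ᵐ x, x ∈ Ω → (u x = 0 ∧ v x = 0) ∨ (u x = 1 ∧ v x = 0) ∨ (u x = 0 ∧ v x = 1))
    {a : ℂ} (ha0 : a ≠ 0) (ha1 : a ≠ 1) {h : Fin n → ℂ}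
    (hw : WeakDirDerivZero Ω h (u + fun x => a * v x)) :
    WeakDirDerivZero Ω h u ∧ WeakDirDerivZero Ω h v := by
  set w := u + fun x => a * v x with hwdef
  have hwm : MemLp w ⊤ volume := hu.add (hv.const_mul a)
  have hww : MemLp (w * w) ⊤ volume := hwm.mul hwm
  have h1a : 1 - a ≠ 0 := sub_ne_zero.2 ha1.symm
  have hq (b : ℂ) : WeakDirDerivZero Ω h (w * w + fun x => b * w x) :=
    (hw.mul hwm hwm hw).add hww (hwm.const_mul b) (hw.const_mul b)
  constructor
  -- Lagrange interpolation at the nodes 0, 1, `a`: `u = w (w - a) / (1 - a)`, and below `v = w (w -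
  -- 1) / (a (a - 1))`.
  · refine ((hq (-a)).const_mul (1 - a)⁻¹).congr ?_
    filter_upwards [huv] with x hx hxΩ
    rcases hx hxΩ with ⟨h1, h2⟩ | ⟨h1, h2⟩ | ⟨h1, h2⟩ <;> simp [hwdef, h1, h2]
    rw [← sub_eq_add_neg, inv_mul_cancel₀ h1a]
  · refine ((hq (-1)).const_mul (a * (a - 1))⁻¹).congr ?_
    filter_upwards [huv] with x hx hxΩ
    rcases hx hxΩ with ⟨h1, h2⟩ | ⟨h1, h2⟩ | ⟨h1, h2⟩ <;> simp [hwdef, h1, h2]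
    have : a - 1 ≠ 0 := sub_ne_zero.2 ha1
    field_simp
    ring

/-- The directions killing both `u` and `v` form a subspace, so it suffices that it contains each
generalized eigenspace of `M`. -/
theorem weakDirDerivZero_of_coupled {u v : EuclideanSpace ℝ (Fin n) → ℂ}
    (hu : MemLp u ⊤ volume) (hv : MemLp v ⊤ volume)
    (huv : ∀ᵐ x, x ∈ Ω → (u x = 0 ∧ v x = 0) ∨ (u x = 1 ∧ v x = 0) ∨ (u x = 0 ∧ v x = 1))
    (M : Module.End ℂ (Fin n → ℂ)) (hM0 : ∀ h, M h = 0 → h = 0) (hM1 : ∀ h, M h = h → h = 0)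
    (hM : ∀ (φ : 𝓓(Ω, ℂ)) (h : Fin n → ℂ), weakDeriv u φ h + weakDeriv v φ (M h) = 0)
    (h : Fin n → ℂ) : WeakDirDerivZero Ω h u ∧ WeakDirDerivZero Ω h v := by
  let V : Submodule ℂ (Fin n → ℂ) :=
    ⨅ φ : 𝓓(Ω, ℂ), LinearMap.ker (weakDeriv u φ) ⊓ LinearMap.ker (weakDeriv v φ)
  have hV {h : Fin n → ℂ} : h ∈ V ↔ WeakDirDerivZero Ω h u ∧ WeakDirDerivZero Ω h v := by
    simp [V, weakDirDerivZero_iff hu, weakDirDerivZero_iff hv, forall_and]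
  suffices hle : ∀ a, M.maxGenEigenspace a ≤ V by
    rw [← hV]
    exact iSup_le hle (Module.End.iSup_maxGenEigenspace_eq_top M ▸ Submodule.mem_top)
  intro a h hh
  obtain ⟨k, hk⟩ := (Module.End.mem_maxGenEigenspace M a h).1 hh
  clear hh
  induction k generalizing h with
  | zero =>
    have : h = 0 := by simpa using hk
    exact this ▸ V.zero_mem
  | succ k ih =>
    rw [pow_succ, Module.End.mul_apply] at hk
    have hg : (M - a • (1 : Module.End ℂ (Fin n → ℂ))) h ∈ V := ih hk
    have hinj (hker : ∀ h, (M - a • (1 : Module.End ℂ (Fin n → ℂ))) h = 0 → h = 0) :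
        h = 0 := by
      rw [← Module.End.mul_apply, ← pow_succ, Module.End.coe_pow] at hk
      exact ((injective_iff_map_eq_zero _).2 hker).iterate _ (hk.trans (iterate_map_zero _ _).symm)
    by_cases ha0 : a = 0
    · rw [hinj fun h hh => hM0 h (by simpa [ha0] using hh)]
      exact V.zero_mem
    by_cases ha1 : a = 1
    · rw [hinj fun h hh => hM1 h (by simpa [ha1, sub_eq_zero] using hh)]
      exact V.zero_mem
    -- With `g = M h - a h` already in `V`, the relation reads `∂_h (u + a v) = -∂_g v = 0`.
    refine hV.2 (WeakDirDerivZero.of_add_const_mul hu hv huv ha0 ha1 fun φ => ?_)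
    have hc := continuous_dirDeriv (h := h) φ.contDiff
    have hs := hasCompactSupport_dirDeriv (h := h) φ.hasCompactSupport
    have hgφ := (weakDirDerivZero_iff hv).1 (hV.1 hg).2 φ
    simp only [LinearMap.sub_apply, LinearMap.smul_apply, Module.End.one_apply, map_sub, map_smul,
      smul_eq_mul] at hgφ
    simp only [Pi.add_apply, add_mul, mul_assoc]
    rw [integral_add (hu.integrable_mul_of_hasCompactSupport hc hs)
      ((hv.integrable_mul_of_hasCompactSupport hc hs).const_mul a), integral_const_mul,
      ← weakDeriv_apply hu, ← weakDeriv_apply hv]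
    linear_combination hM φ h - hgφ

end Coupled

/-! ### A common left multiplier -/

/-- Finitely many matrices of full column rank have a common matrix multiplying all of them on the
left to invertible matrices. -/
theorem Matrix.exists_forall_det_mul_ne_zero {m n ι : Type*} [Fintype m] [Fintype n]
    [DecidableEq n] (X : ι → Matrix m n ℝ) (s : Finset ι)
    (hX : ∀ k ∈ s, (X k).rank = Fintype.card n) :
    ∃ L : Matrix n m ℝ, ∀ k ∈ s, (L * X k).det ≠ 0 := by
  classical
  induction s using Finset.induction_on with
  | empty => exact ⟨0, by simp⟩
  | insert a s has ih =>
    obtain ⟨L, hL⟩ := ih fun k hk => hX k (Finset.mem_insert_of_mem hk)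
    have hdet : ((X a)ᵀ * X a).det ≠ 0 := by
      intro h0
      obtain ⟨v, hv, hv0⟩ := Matrix.exists_mulVec_eq_zero_iff.2 h0
      have hrank := (X a)ᵀ * X a |>.mulVecLin.finrank_range_add_finrank_ker
      rw [← Matrix.rank, Matrix.rank_transpose_mul_self, hX a (Finset.mem_insert_self a s),
        Module.finrank_fintype_fun_eq_card, Nat.add_eq_left, Submodule.finrank_eq_zero] at hrank
      exact hv ((Submodule.eq_bot_iff _).1 hrank v hv0)
    -- Perturb `L` to `t • (X a)ᵀ + L`: as a polynomial in `t`, the determinant has nonzero top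
    -- coefficient for `k = a` and nonzero constant term for the earlier `k`.
    let p (k : ι) : Polynomial ℝ := Matrix.det ((Polynomial.X : Polynomial ℝ) •
      ((X a)ᵀ * X k).map Polynomial.C + (L * X k).map Polynomial.C)
    have hp : ∏ k ∈ insert a s, p k ≠ 0 := by
      refine Finset.prod_ne_zero_iff.2 fun k hk h0 => ?_
      rcases Finset.mem_insert.1 hk with rfl | hk
      · apply hdet
        rw [← Polynomial.coeff_det_X_add_C_card _ (L * X k)]
        exact (congrArg (Polynomial.coeff · _) h0).trans (Polynomial.coeff_zero _)
      · apply hL k hk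
        rw [← Polynomial.coeff_det_X_add_C_zero ((X a)ᵀ * X k)]
        exact (congrArg (Polynomial.coeff · _) h0).trans (Polynomial.coeff_zero _)
    obtain ⟨t, ht⟩ : ∃ t, (∏ k ∈ insert a s, p k).eval t ≠ 0 := by
      by_contra! hall
      exact hp (Polynomial.funext fun t => by rw [hall t, Polynomial.eval_zero])
    refine ⟨t • (X a)ᵀ + L, fun k hk => ?_⟩
    rw [Polynomial.eval_prod, Finset.prod_ne_zero_iff] at ht
    convert ht k hk
    simp only [p, ← Polynomial.coe_evalRingHom, RingHom.map_det]
    congr 1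
    ext i j
    simp [Matrix.add_mul, -Matrix.map_mul, mul_comm t]

/-! ### Phase indicators and the rows of the divergence equation -/

section PhaseIndicator

variable {m n : ℕ} {Ω : Opens (EuclideanSpace ℝ (Fin n))}
  {B : EuclideanSpace ℝ (Fin n) → Matrix (Fin m) (Fin n) ℝ}

/-- The indicator function of the part of `Ω` where `B` takes the value `A`. -/
noncomputable def phaseIndicator (Ω : Opens (EuclideanSpace ℝ (Fin n)))
    (B : EuclideanSpace ℝ (Fin n) → Matrix (Fin m) (Fin n) ℝ) (A : Matrix (Fin m) (Fin n) ℝ) :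
    EuclideanSpace ℝ (Fin n) → ℂ :=
  (Ω : Set (EuclideanSpace ℝ (Fin n))).indicator ({x | B x = A}.indicator 1)

theorem memLp_phaseIndicator
    (hB : ∀ (i : Fin m) (j : Fin n), AEMeasurable (fun x => B x i j)
      (volume.restrict (Ω : Set (EuclideanSpace ℝ (Fin n)))))
    (A : Matrix (Fin m) (Fin n) ℝ) : MemLp (phaseIndicator Ω B A) ⊤ volume := by
  have hS : NullMeasurableSet {x | B x = A}
      (volume.restrict (Ω : Set (EuclideanSpace ℝ (Fin n)))) := by
    have : {x | B x = A} = ⋂ i, ⋂ j, {x | B x i j = A i j} := by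
      ext x
      simp [← Matrix.ext_iff]
    rw [this]
    exact .iInter fun i => .iInter fun j => nullMeasurableSet_eq_fun (hB i j) aemeasurable_const
  refine memLp_top_of_bound ((aestronglyMeasurable_indicator_iff Ω.isOpen.measurableSet).2
    (aestronglyMeasurable_one.indicator₀ hS)) 1 (.of_forall fun x => ?_)
  refine (norm_indicator_le_norm_self _ x).trans ((norm_indicator_le_norm_self _ x).trans ?_)
  simp

theorem phaseIndicator_eq_ite {A : Matrix (Fin m) (Fin n) ℝ} {x} (hx : x ∈ Ω)
    [Decidable (B x = A)] : phaseIndicator Ω B A x = if B x = A then 1 else 0 := by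
  rw [phaseIndicator, Set.indicator_of_mem (show x ∈ (Ω : Set _) from hx)]
  by_cases h : B x = A
  · rw [Set.indicator_of_mem (show x ∈ {x | B x = A} from h), if_pos h, Pi.one_apply]
  · rw [Set.indicator_of_notMem (show x ∉ {x | B x = A} from h), if_neg h]

theorem MeasureTheory.MemLp.integrable_mul_dirDeriv {f : EuclideanSpace ℝ (Fin n) → ℂ}
    (hf : MemLp f ⊤ volume) (φ : 𝓓(Ω, ℂ)) (h : Fin n → ℂ) :
    Integrable fun x => f x * dirDeriv h φ x :=
  hf.integrable_mul_of_hasCompactSupport (continuous_dirDeriv φ.contDiff)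
    (hasCompactSupport_dirDeriv φ.hasCompactSupport)

/-- Complex test functions may be used in the definition of `DivEqZero`. -/
theorem DivEqZero.integral_eq_zero (hB : DivEqZero Ω B) (i : Fin m) (φ : 𝓓(Ω, ℂ))
    (hi : IntegrableOn (fun x => ∑ j, (B x i j : ℂ) * fderiv ℝ φ x (EuclideanSpace.single j 1))
      (Ω : Set (EuclideanSpace ℝ (Fin n)))) :
    ∫ x in (Ω : Set (EuclideanSpace ℝ (Fin n))),
      ∑ j, (B x i j : ℂ) * fderiv ℝ φ x (EuclideanSpace.single j 1) = 0 := by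
  have key (L : ℂ →L[ℝ] ℝ) : L (∫ x in (Ω : Set (EuclideanSpace ℝ (Fin n))),
      ∑ j, (B x i j : ℂ) * fderiv ℝ φ x (EuclideanSpace.single j 1)) = 0 := by
    let ψ : 𝓓(Ω, ℝ) := ⟨fun x => L (φ x), L.contDiff.comp φ.contDiff,
      φ.hasCompactSupport.comp_left L.map_zero,
      (tsupport_comp_subset L.map_zero φ).trans φ.tsupport_subset⟩
    have hψ (x v : EuclideanSpace ℝ (Fin n)) : fderiv ℝ ψ x v = L (fderiv ℝ φ x v) := by
      have hd := ((φ.contDiff.differentiable (by simp)) x).hasFDerivAt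
      have : HasFDerivAt ψ (L ∘L fderiv ℝ φ x) x := L.hasFDerivAt.comp x hd
      rw [this.fderiv, ContinuousLinearMap.comp_apply]
    rw [← L.integral_comp_comm hi, ← hB i ψ]
    refine integral_congr_ae (.of_forall fun x => ?_)
    simp only [map_sum, hψ]
    refine Finset.sum_congr rfl fun j _ => ?_
    rw [← Complex.real_smul, L.map_smul, smul_eq_mul]
  exact Complex.ext (key Complex.reCLM) (key Complex.imCLM)

/-- The constant part `A 0` of the expansion of `B` drops out, since a test function has derivatives
of integral zero. -/
theorem DivEqZero.weakDeriv_row {A : Fin 3 → Matrix (Fin m) (Fin n) ℝ}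
    (hA : Function.Injective A)
    (hBmeas : ∀ (i : Fin m) (j : Fin n), AEMeasurable (fun x => B x i j)
      (volume.restrict (Ω : Set (EuclideanSpace ℝ (Fin n)))))
    (hBK : ∀ᵐ x ∂(volume.restrict (Ω : Set (EuclideanSpace ℝ (Fin n)))), B x ∈ Set.range A)
    (hB : DivEqZero Ω B) (φ : 𝓓(Ω, ℂ)) (i : Fin m) :
    weakDeriv (phaseIndicator Ω B (A 1)) φ (((A 1 - A 0).map Complex.ofReal) i) +
      weakDeriv (phaseIndicator Ω B (A 2)) φ (((A 2 - A 0).map Complex.ofReal) i) = 0 := by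
  have h1 := memLp_phaseIndicator hBmeas (A 1)
  have h2 := memLp_phaseIndicator hBmeas (A 2)
  set u := phaseIndicator Ω B (A 1)
  set v := phaseIndicator Ω B (A 2)
  set a : Fin n → ℂ := fun j => (A 0 i j : ℂ)
  set b := ((A 1 - A 0).map Complex.ofReal) i
  set c := ((A 2 - A 0).map Complex.ofReal) i
  have i0 : Integrable fun x => dirDeriv a φ x := by
    exact (continuous_dirDeriv φ.contDiff).integrable_of_hasCompactSupport
      (hasCompactSupport_dirDeriv φ.hasCompactSupport)
  have i1 := h1.integrable_mul_dirDeriv φ b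
  have i2 := h2.integrable_mul_dirDeriv φ c
  have i12 : Integrable fun x => u x * dirDeriv b φ x + v x * dirDeriv c φ x := i1.add i2
  have hz : ∫ x, dirDeriv a φ x = 0 := by
    simpa using weakDirDerivZero_const (h := a) 1 φ
  have hae : ∀ᵐ x ∂(volume.restrict (Ω : Set (EuclideanSpace ℝ (Fin n)))),
      dirDeriv a φ x + (u x * dirDeriv b φ x + v x * dirDeriv c φ x) =
        ∑ j, (B x i j : ℂ) * fderiv ℝ φ x (EuclideanSpace.single j 1) := by
    filter_upwards [hBK, ae_restrict_mem Ω.isOpen.measurableSet] with x ⟨k, hk⟩ hx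
    have hu : u x = if k = 1 then 1 else 0 := by
      classical simp [u, phaseIndicator_eq_ite hx, ← hk, hA.eq_iff]
    have hv : v x = if k = 2 then 1 else 0 := by
      classical simp [v, phaseIndicator_eq_ite hx, ← hk, hA.eq_iff]
    simp only [dirDeriv, Finset.mul_sum, ← Finset.sum_add_distrib, hu, hv, ← hk]
    refine Finset.sum_congr rfl fun j _ => ?_
    fin_cases k <;> simp [a, b, c, sub_mul]
  have hsupp : ∫ x in (Ω : Set (EuclideanSpace ℝ (Fin n))),
      (dirDeriv a φ x + (u x * dirDeriv b φ x + v x * dirDeriv c φ x)) =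
      ∫ x, (dirDeriv a φ x + (u x * dirDeriv b φ x + v x * dirDeriv c φ x)) := by
    refine setIntegral_eq_integral_of_forall_compl_eq_zero fun x hx => ?_
    have : fderiv ℝ φ x = 0 := image_eq_zero_of_notMem_tsupport fun hx' =>
      hx (φ.tsupport_subset (tsupport_fderiv_subset ℝ hx'))
    simp [dirDeriv, this]
  have h0 := hB.integral_eq_zero i φ (((i0.add i12).integrableOn).congr hae)
  rw [← integral_congr_ae hae, hsupp, integral_add i0 i12, integral_add i1 i2, hz,
    zero_add, ← weakDeriv_apply h1, ← weakDeriv_apply h2] at h0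
  exact h0

end PhaseIndicator

end WeakDerivatives

/-! ### The three-phase theorem -/

open scoped Matrix

theorem theorem1p5 {m n : ℕ} (hmn : n ≤ m)
    (Ω : Opens (EuclideanSpace ℝ (Fin n)))
    (hΩ : IsConnected (Ω : Set (EuclideanSpace ℝ (Fin n))))
    (A : Fin 3 → Matrix (Fin m) (Fin n) ℝ)
    (hA : ∀ k l : Fin 3, k ≠ l → (A k - A l).rank = n)
    (B : EuclideanSpace ℝ (Fin n) → Matrix (Fin m) (Fin n) ℝ)
    (hBmeas : ∀ (i : Fin m) (j : Fin n), AEMeasurable (fun x => B x i j)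
      (volume.restrict (Ω : Set (EuclideanSpace ℝ (Fin n)))))
    (hBK : ∀ᵐ x ∂(volume.restrict (Ω : Set (EuclideanSpace ℝ (Fin n)))), B x ∈ Set.range A)
    (hBdiv : DivEqZero Ω B) :
    ∃ k : Fin 3, ∀ᵐ x ∂(volume.restrict (Ω : Set (EuclideanSpace ℝ (Fin n)))), B x = A k := by
  rcases Nat.eq_zero_or_pos n with rfl | hn
  -- Without columns the rank condition cannot separate the `A k`, but all matrices coincide.
  · exact ⟨0, .of_forall fun x => Subsingleton.elim _ _⟩
  have hinj : Function.Injective A := by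
    intro k l hkl
    by_contra hne
    have := hA k l hne
    rw [hkl, sub_self, Matrix.rank_zero] at this
    omega
  have hu := memLp_phaseIndicator hBmeas (A 1)
  have hv := memLp_phaseIndicator hBmeas (A 2)
  have hval (k : Fin 3) : ∀ᵐ x, x ∈ Ω → ∃ l, B x = A l ∧
      phaseIndicator Ω B (A k) x = if l = k then 1 else 0 := by
    filter_upwards [(ae_restrict_iff' Ω.isOpen.measurableSet).1 hBK] with x hx hxΩ
    obtain ⟨l, hl⟩ := hx hxΩ
    classical exact ⟨l, hl.symm, by simp [phaseIndicator_eq_ite hxΩ, ← hl, hinj.eq_iff]⟩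
  have huv : ∀ᵐ x, x ∈ Ω →
      (phaseIndicator Ω B (A 1) x = 0 ∧ phaseIndicator Ω B (A 2) x = 0) ∨
      (phaseIndicator Ω B (A 1) x = 1 ∧ phaseIndicator Ω B (A 2) x = 0) ∨
      (phaseIndicator Ω B (A 1) x = 0 ∧ phaseIndicator Ω B (A 2) x = 1) := by
    filter_upwards [hval 1, hval 2] with x h1 h2 hx
    obtain ⟨l, hl, h1⟩ := h1 hx
    obtain ⟨l', hl', h2⟩ := h2 hx
    obtain rfl : l = l' := hinj (hl.symm.trans hl')
    rw [h1, h2]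
    fin_cases l <;> simp
  obtain ⟨L, hL⟩ := Matrix.exists_forall_det_mul_ne_zero
    (fun p : Fin 3 × Fin 3 => A p.1 - A p.2) (Finset.univ.filter fun p => p.1 ≠ p.2)
    (fun p hp => by simpa using hA p.1 p.2 (by simpa using hp))
  let D (k : Fin 3) : Matrix (Fin m) (Fin n) ℂ := (A k - A 0).map Complex.ofReal
  let L' : Matrix (Fin n) (Fin m) ℂ := L.map Complex.ofReal
  have hunit (k l : Fin 3) (hkl : k ≠ l) : IsUnit (L' * D k - L' * D l) := by
    rw [Matrix.isUnit_iff_isUnit_det, isUnit_iff_ne_zero]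
    have h1 : L' * D k - L' * D l = (L * (A k - A l)).map Complex.ofRealHom := by
      rw [← Matrix.mul_sub, Matrix.map_mul]
      congr 1
      ext i j
      simp [D]
    rw [h1, ← RingHom.mapMatrix_apply, ← RingHom.map_det]
    simpa using hL (k, l) (by simpa using hkl)
  have hD0 : D 0 = 0 := by ext; simp [D]
  have hP : IsUnit (L' * D 1) := by simpa [hD0] using hunit 1 0 (by decide)
  have hQ : IsUnit (L' * D 2) := by simpa [hD0] using hunit 2 0 (by decide)
  have hPQ := hunit 2 1 (by decide)
  have hrow (φ : 𝓓(Ω, ℂ)) (r : Fin m → ℂ) :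
      weakDeriv (phaseIndicator Ω B (A 1)) φ (r ᵥ* D 1) +
        weakDeriv (phaseIndicator Ω B (A 2)) φ (r ᵥ* D 2) = 0 := by
    have : weakDeriv (phaseIndicator Ω B (A 1)) φ ∘ₗ (D 1).vecMulLinear +
        weakDeriv (phaseIndicator Ω B (A 2)) φ ∘ₗ (D 2).vecMulLinear = 0 := by
      refine (Pi.basisFun ℂ (Fin m)).ext fun i => ?_
      simpa [D, Matrix.row] using hBdiv.weakDeriv_row hinj hBmeas hBK φ i
    exact LinearMap.congr_fun this r
  have hdet := (Matrix.isUnit_iff_isUnit_det _).1 hP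
  have hPi : IsUnit (L' * D 1)⁻¹ := Matrix.isUnit_nonsing_inv_iff.2 hP
  have hzero := weakDirDerivZero_of_coupled hu hv huv
    ((L' * D 1)⁻¹ * (L' * D 2)).vecMulLinear
    (fun h hh => Matrix.vecMul_injective_of_isUnit (hPi.mul hQ) (by simpa using hh))
    (fun h hh => Matrix.vecMul_injective_of_isUnit (hPi.mul hPQ) (by
      simpa [Matrix.mul_sub, Matrix.nonsing_inv_mul _ hdet, Matrix.vecMul_sub, sub_eq_zero]
        using hh))
    (fun φ h => by
      -- This combination of rows turns `D 1` into `h` and `D 2` into `M h`.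
      have := hrow φ ((h ᵥ* (L' * D 1)⁻¹) ᵥ* L')
      rw [Matrix.vecMul_vecMul _ L', Matrix.vecMul_vecMul _ L', Matrix.vecMul_vecMul,
        Matrix.vecMul_vecMul, Matrix.nonsing_inv_mul _ hdet, Matrix.vecMul_one] at this
      exact this)
  -- `u + 2 v` equals `l` on phase `l`, so one scalar function records the phase.
  have hw : MemLp (phaseIndicator Ω B (A 1) + fun x => 2 * phaseIndicator Ω B (A 2) x) ⊤
      volume := hu.add (hv.const_mul 2)
  obtain ⟨c, hc⟩ := ae_const_of_weakDirDerivZero hΩ hw fun h =>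
    (hzero h).1.add hu (hv.const_mul 2) ((hzero h).2.const_mul 2)
  have hall : ∀ᵐ x, x ∈ Ω → ∃ l : Fin 3, B x = A l ∧ c = (l : ℕ) := by
    filter_upwards [hval 1, hval 2, hc] with x h1 h2 hc hx
    obtain ⟨l, hl, h1⟩ := h1 hx
    obtain ⟨l', hl', h2⟩ := h2 hx
    obtain rfl : l = l' := hinj (hl.symm.trans hl')
    refine ⟨l, hl, ?_⟩
    rw [← hc hx, Pi.add_apply, h1, h2]
    fin_cases l <;> simp
  obtain ⟨x, hx, hxl⟩ := Measure.exists_mem_of_measure_ne_zero_of_ae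
    (Ω.isOpen.measure_pos volume hΩ.nonempty).ne' (ae_restrict_of_ae hall)
  obtain ⟨k, -, hck⟩ := hxl hx
  refine ⟨k, (ae_restrict_iff' Ω.isOpen.measurableSet).2 ?_⟩
  filter_upwards [hall] with y hy hyΩ
  obtain ⟨l, hl, hcl⟩ := hy hyΩ
  have : l = k := Fin.ext (by exact_mod_cast hcl.symm.trans hck)
  exact this ▸ hl
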